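/- Let $d \ge 1$ be an integer and let $\mathcal{A}$ and $\mathcal{B}$ be finite alphabets with at least two symbols each. For a finite set $\mathcal{C}$, give $\mathcal{C}^{\mathbb{Z}^d}$ the product topology ($\mathcal{C}$ being discrete) and let $\mathbb{Z}^d$ act on it by the shift, $(g\cdot x)_a = x_{a+g}$. Let $\mathrm{Aut}^{(\infty)}(\mathcal{C}^{\mathbb{Z}^d},\mathbb{Z}^d)$ be the group, under composition, of all homeomorphisms $\varphi\colon \mathcal{C}^{\mathbb{Z}^d}\to\mathcal{C}^{\mathbb{Z}^d}$ for which there is a finite index subgroup $H\subseteq\mathbb{Z}^d$ such that $\varphi(h\cdot x)=h\cdot\varphi(x)$ for all $h\in H$ and all $x\in\mathcal{C}^{\mathbb{Z}^d}$. Then the groups $\mathrm{Aut}^{(\infty)}(\mathcal{A}^{\mathbb{Z}^d},\mathbb{Z}^d)$ and $\mathrm{Aut}^{(\infty)}(\mathcal{B}^{\mathbb{Z}^d},\mathbb{Z}^d)$ are isomorphic if and only if there exist positive integers $m,n$ such that $|\mathcal{A}|^m=|\mathcal{B}|^n$. -/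

import Mathlib

/-- The automorphism group `Aut(X, G)` of a `G`-system (`G` written additively): the
self-homeomorphisms of `X` that commute with the action of every element of `G`. -/
def systemAut (G X : Type*) [AddGroup G] [TopologicalSpace X] [AddAction G X] :
    Subgroup (X ≃ₜ X) where
  carrier := {φ | ∀ (g : G) (x : X), φ (g +ᵥ x) = g +ᵥ φ x}
  mul_mem' := by
    intro φ ψ hφ hψ g x
    simp only [Homeomorph.mul_apply]
    rw [hψ, hφ]
  one_mem' := fun _ _ => rfl
  inv_mem' := by
    intro φ hφ g x
    apply φ.injective
    rw [hφ]
    change φ (φ.symm _) = g +ᵥ φ (φ.symm x)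
    rw [φ.apply_symm_apply, φ.apply_symm_apply]

/-- Restricting the action to a smaller subgroup enlarges the automorphism group. -/
theorem systemAut_anti {G X : Type*} [AddGroup G] [TopologicalSpace X] [AddAction G X]
    {H K : AddSubgroup G} (h : H ≤ K) : systemAut K X ≤ systemAut H X :=
  fun _ hφ g x => hφ ⟨g.1, h g.2⟩ x

/-- The stabilized automorphism group of a `G`-system: the union of the groups `Aut(X, H)`
over all finite index subgroups `H` of `G`. -/
def stabilizedAut (G X : Type*) [AddGroup G] [TopologicalSpace X] [AddAction G X] :
    Subgroup (X ≃ₜ X) where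
  carrier := {φ | ∃ H : AddSubgroup G, H.FiniteIndex ∧ φ ∈ systemAut H X}
  mul_mem' := by
    rintro φ ψ ⟨H, hH, hφ⟩ ⟨K, hK, hψ⟩
    exact ⟨H ⊓ K, inferInstance,
      mul_mem (systemAut_anti inf_le_left hφ) (systemAut_anti inf_le_right hψ)⟩
  one_mem' := ⟨⊤, inferInstance, one_mem _⟩
  inv_mem' := by
    rintro φ ⟨H, hH, hφ⟩
    exact ⟨H, hH, inv_mem hφ⟩

/-- The configuration space `A ^ G`. -/
def FullShift (A G : Type*) : Type _ := G → A

/-- The product topology, with the alphabet `A` discrete. -/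
instance FullShift.instTopologicalSpace (A G : Type*) : TopologicalSpace (FullShift A G) :=
  @Pi.topologicalSpace G (fun _ => A) (fun _ => ⊥)

/-- The shift action `(g · x)_a = x_{a + g}`. -/
instance FullShift.instAddAction (A G : Type*) [AddGroup G] : AddAction G (FullShift A G) where
  vadd g x := fun a => x (a + g)
  zero_vadd x := funext fun a => congrArg x (add_zero a)
  add_vadd g h x := funext fun a => congrArg x (add_assoc a g h).symm

/-!
Write `X = A ^ G` with `G = ℤ ^ d`, let `σ` be the shift, and for a finite index subgroup `K` of
`G` write `Aut(X, K)` for the group of homeomorphisms commuting with the shifts by `K`.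

If `|A| ^ m = |B| ^ n`, recode configurations by blocks: for a subgroup of index `m` isomorphic to
`G`, a configuration over `A` is a configuration over `A ^ m`, and this does not change the
stabilized automorphism group (`nonempty_stabilizedAut_fullShift_mulEquiv`). Hence both groups are
the group of the alphabet `A ^ m`. The same recoding allows one to assume in the converse direction
that the alphabets are products `P × Q` with at least five symbols.

For the converse, the shifts are first recovered from the group. The permutations of the alphabet
`P × Q` and the shifts of the `P`-coordinates alone form a finitely generated group whose
centralizer consists of shifts (`FullShift.exists_eq_shift_of_commute`): a map commuting with them
moves a configuration with a single mark by a shift, and the orbit of that configuration is dense.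
Given an isomorphism `Ψ` from the group of `A` to the group of `B`, each of the finitely many
generators is sent to a map commuting with the shifts by a finite index subgroup. So there are a
finite index subgroup `L` and an injective `θ : L → G` with `Ψ (σ (θ l)) = σ l` for `l ∈ L`
(`FullShift.exists_hom_stabShift`). Therefore `Ψ` maps `Aut(A ^ G, θ κ)` onto `Aut(B ^ G, κ)` for
every `κ ≤ L`.

Finally, `|A| ^ [G : K]` is recovered from `Aut(X, K)` as the least degree of a permutation
representation that does not kill a given element. If the given element is a symbol permutation of
order three, the degree is at least `|A| ^ [G : K]`: the symmetric group on the patterns on `G / K`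
embeds in `Aut(X, K)` and contains the element as an even permutation, so the representation is
faithful on it (`FullShift.card_pow_index_le`). For an arbitrary nontrivial element and `K` deep
enough, the action on the `|A| ^ [G : K]` configurations fixed by `K` does not kill the element,
because periodic configurations are dense (`FullShift.exists_perm_rep_of_fixed`,
`FullShift.exists_periodic_ne`). Comparing both bounds along `Ψ` and along its inverse gives
`|A| ^ [G : θ κ] = |B| ^ [G : κ]` for `κ` deep enough.
-/

/-! ### Homeomorphisms between full shifts -/

namespace FullShift

section Basic

variable {A B G G' : Type*}

@[simp]
theorem vadd_apply [AddGroup G] (g : G) (x : FullShift A G) (a : G) :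
    (g +ᵥ x) a = x (a + g) := rfl

/-- A map between full shifts is continuous as soon as every coordinate of the image depends on
finitely many coordinates of the argument. -/
theorem continuous_of_finite_dependence (f : FullShift A G → FullShift B G')
    (h : ∀ b : G', ∃ S : Set G, S.Finite ∧ ∀ x y : FullShift A G,
      (∀ a ∈ S, x a = y a) → f x b = f y b) : Continuous f := by
  let _ : TopologicalSpace A := ⊥
  let _ : TopologicalSpace B := ⊥
  have : DiscreteTopology A := ⟨rfl⟩
  have : DiscreteTopology B := ⟨rfl⟩
  refine continuous_pi (A := fun _ : G' => B) fun b => ?_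
  obtain ⟨S, hS, hf⟩ := h b
  refine continuous_iff_continuousAt.2 fun x => ?_
  refine (continuousAt_const (y := f x b)).congr ?_
  have hopen : {y : G → A | ∀ a ∈ S, y a = x a} ∈ nhds (x : G → A) := by
    have : {y : G → A | ∀ a ∈ S, y a = x a} = S.pi fun a => {x a} := by
      ext y; simp [Set.mem_pi]
    rw [this]
    exact set_pi_mem_nhds hS fun a _ => by simp
  filter_upwards [hopen] with y hy
  exact hf x y fun a ha => (hy a ha).symm

instance : T2Space (FullShift A G) := by
  let _ : TopologicalSpace A := ⊥
  have : DiscreteTopology A := ⟨rfl⟩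
  exact inferInstanceAs (T2Space (G → A))

theorem exists_window_of_mem_nhds {x : FullShift A G} {t : Set (FullShift A G)}
    (ht : t ∈ nhds x) :
    ∃ W : Finset G, ∀ y : FullShift A G, (∀ a ∈ W, y a = x a) → y ∈ t := by
  let _ : TopologicalSpace A := ⊥
  have : DiscreteTopology A := ⟨rfl⟩
  have key : ∀ (x : G → A) (t : Set (G → A)), t ∈ nhds x →
      ∃ W : Finset G, ∀ y : G → A, (∀ a ∈ W, y a = x a) → y ∈ t := by
    intro x t ht
    rw [nhds_pi, Filter.mem_pi] at ht
    obtain ⟨I, hI, u, hu, hut⟩ := ht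
    refine ⟨hI.toFinset, fun y hy => hut fun a ha => ?_⟩
    rw [hy a (by simpa using ha)]
    exact mem_of_mem_nhds (hu a)
  exact key x t ht

/-- A set of configurations is dense as soon as it realizes every pattern on every finite
window. -/
theorem dense_of_forall_window (s : Set (FullShift A G))
    (h : ∀ (W : Finset G) (x : FullShift A G), ∃ y ∈ s, ∀ a ∈ W, y a = x a) : Dense s := by
  intro x
  refine mem_closure_iff_nhds.2 fun t ht => ?_
  obtain ⟨W, hW⟩ := exists_window_of_mem_nhds ht
  obtain ⟨y, hys, hy⟩ := h W x
  exact ⟨y, hW y hy, hys⟩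

/-- Renaming the symbols. -/
def relabel (e : A ≃ B) : FullShift A G ≃ₜ FullShift B G where
  toFun x := fun a => e (x a)
  invFun y := fun a => e.symm (y a)
  left_inv x := funext fun a => e.symm_apply_apply _
  right_inv y := funext fun a => e.apply_symm_apply _
  continuous_toFun := continuous_of_finite_dependence _ fun b =>
    ⟨{b}, Set.finite_singleton b, fun x y h => by simp [h b rfl]⟩
  continuous_invFun := continuous_of_finite_dependence _ fun b =>
    ⟨{b}, Set.finite_singleton b, fun x y h => by simp [h b rfl]⟩

theorem relabel_vadd [AddGroup G] (e : A ≃ B) (g : G) (x : FullShift A G) :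
    relabel e (g +ᵥ x) = g +ᵥ relabel e x := rfl

/-- The permutations of the alphabet, acting on all cells at once. -/
def symbolPerm (A G : Type*) : Equiv.Perm A →* (FullShift A G ≃ₜ FullShift A G) where
  toFun π := relabel π
  map_one' := rfl
  map_mul' _ _ := rfl

@[simp]
theorem symbolPerm_apply (π : Equiv.Perm A) (x : FullShift A G) (a : G) :
    symbolPerm A G π x a = π (x a) := rfl

end Basic

section Block

variable {A G K : Type*} [AddCommGroup G] [AddCommGroup K]

/-- For an injective homomorphism `i : K → G`, every element of `G` is uniquely the sum of an
element of the image and a chosen representative of a coset. -/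
noncomputable def cosetEquiv (i : K →+ G) (hi : Function.Injective i) :
    K × (G ⧸ i.range) ≃ G :=
  Equiv.ofBijective (fun p => i p.1 + p.2.out) <| by
    constructor
    · rintro ⟨k, q⟩ ⟨k', q'⟩ h
      simp only at h
      have hq : q = q' := by
        rw [← QuotientAddGroup.out_eq' q, ← QuotientAddGroup.out_eq' q', QuotientAddGroup.eq]
        exact ⟨k - k', by
          rw [map_sub, eq_neg_add_of_add_eq h.symm]; abel⟩
      subst hq
      rw [hi (add_right_cancel h)]
    · intro g
      obtain ⟨k, hk⟩ : -(QuotientAddGroup.mk g : G ⧸ i.range).out + g ∈ i.range := by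
        rw [← QuotientAddGroup.eq]
        exact QuotientAddGroup.out_eq' _
      exact ⟨(k, QuotientAddGroup.mk g), by simp [hk]⟩

theorem cosetEquiv_add (i : K →+ G) (hi : Function.Injective i) (k k' : K) (q : G ⧸ i.range) :
    cosetEquiv i hi (k + k', q) = cosetEquiv i hi (k, q) + i k' := by
  change i (k + k') + q.out = i k + q.out + i k'
  rw [map_add]
  abel

/-- Higher block recoding: a configuration on `G` is read as a configuration on a finite index
subgroup, the new symbols being the old patterns on a system of coset representatives. -/
noncomputable def block (A : Type*) (i : K →+ G) (hi : Function.Injective i)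
    [Finite (G ⧸ i.range)] :
    FullShift A G ≃ₜ FullShift (G ⧸ i.range → A) K where
  toFun x := fun k q => x (cosetEquiv i hi (k, q))
  invFun y := fun g => y ((cosetEquiv i hi).symm g).1 ((cosetEquiv i hi).symm g).2
  left_inv x := funext fun g => by simp
  right_inv y := funext fun k => funext fun q => by simp
  continuous_toFun := continuous_of_finite_dependence _ fun k =>
    ⟨Set.range fun q => cosetEquiv i hi (k, q), Set.finite_range _,
      fun x y h => funext fun q => h _ ⟨q, rfl⟩⟩
  continuous_invFun := continuous_of_finite_dependence _ fun g =>
    ⟨{((cosetEquiv i hi).symm g).1}, Set.finite_singleton _, fun x y h => by simp [h _ rfl]⟩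

theorem block_vadd (i : K →+ G) (hi : Function.Injective i) [Finite (G ⧸ i.range)]
    (k : K) (x : FullShift A G) : block A i hi (i k +ᵥ x) = k +ᵥ block A i hi x :=
  funext fun k' => funext fun q => congrArg x (cosetEquiv_add i hi k' k q).symm

end Block

end FullShift

/-! ### Transport of stabilized automorphism groups -/

/-- Conjugation by a homeomorphism. -/
def Homeomorph.conjMulEquiv {X Y : Type*} [TopologicalSpace X] [TopologicalSpace Y]
    (f : X ≃ₜ Y) : (X ≃ₜ X) ≃* (Y ≃ₜ Y) where
  toFun φ := (f.symm.trans φ).trans f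
  invFun ψ := (f.trans ψ).trans f.symm
  left_inv φ := by ext x; simp
  right_inv ψ := by ext x; simp
  map_mul' φ ψ := by ext x; simp

@[simp]
theorem Homeomorph.conjMulEquiv_apply {X Y : Type*} [TopologicalSpace X] [TopologicalSpace Y]
    (f : X ≃ₜ Y) (φ : X ≃ₜ X) (y : Y) : f.conjMulEquiv φ y = f (φ (f.symm y)) := rfl

section Transport

theorem AddSubgroup.FiniteIndex.comap {G K : Type*} [AddGroup G] [AddGroup K] (i : K →+ G)
    {H : AddSubgroup G} (hH : H.FiniteIndex) : (H.comap i).FiniteIndex :=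
  ⟨by
    rw [AddSubgroup.index_comap]
    exact fun h => hH.index_ne_zero (AddSubgroup.index_eq_zero_of_relIndex_eq_zero h)⟩

theorem AddSubgroup.FiniteIndex.map_of_injective {G K : Type*} [AddGroup G] [AddGroup K]
    {i : K →+ G} (hi : Function.Injective i) (hfin : i.range.FiniteIndex) {L : AddSubgroup K}
    (hL : L.FiniteIndex) : (L.map i).FiniteIndex :=
  ⟨by
    rw [AddSubgroup.index_map, (AddMonoidHom.ker_eq_bot_iff i).2 hi, sup_bot_eq]
    exact mul_ne_zero hL.index_ne_zero hfin.index_ne_zero⟩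

variable {G K X Y : Type*} [AddGroup G] [AddGroup K] [TopologicalSpace X] [TopologicalSpace Y]
  [AddAction G X] [AddAction K Y]

theorem Homeomorph.conjMulEquiv_mem_systemAut_iff (i : K →+ G) (f : X ≃ₜ Y)
    (hf : ∀ k x, f (i k +ᵥ x) = k +ᵥ f x) (L : AddSubgroup K) (φ : X ≃ₜ X) :
    f.conjMulEquiv φ ∈ systemAut L Y ↔ φ ∈ systemAut (L.map i) X := by
  constructor
  · rintro h ⟨_, k, hk, rfl⟩ x
    have := h ⟨k, hk⟩ (f x)
    change f (φ (f.symm (k +ᵥ f x))) = k +ᵥ f (φ (f.symm (f x))) at this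
    rw [← hf, ← hf, f.symm_apply_apply, f.symm_apply_apply] at this
    exact f.injective this
  · rintro h ⟨k, hk⟩ y
    obtain ⟨x, rfl⟩ := f.surjective y
    have : φ (i k +ᵥ x) = i k +ᵥ φ x := h ⟨i k, AddSubgroup.mem_map_of_mem i hk⟩ x
    change f (φ (f.symm (k +ᵥ f x))) = k +ᵥ f (φ (f.symm (f x)))
    rw [← hf, ← hf, f.symm_apply_apply, f.symm_apply_apply, this]

/-- A homeomorphism that turns the action of a finite index copy of `K` in `G` into the action of
`K` identifies the stabilized automorphism groups, since finite index subgroups of `K` have finite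
index in `G` and conversely. -/
theorem nonempty_stabilizedAut_mulEquiv (i : K →+ G) (hi : Function.Injective i)
    (hfin : i.range.FiniteIndex) (f : X ≃ₜ Y) (hf : ∀ k x, f (i k +ᵥ x) = k +ᵥ f x) :
    Nonempty (stabilizedAut G X ≃* stabilizedAut K Y) := by
  have hmap : (stabilizedAut G X).map f.conjMulEquiv.toMonoidHom = stabilizedAut K Y := by
    ext ψ
    constructor
    · rintro ⟨φ, ⟨H, hH, hφ⟩, rfl⟩
      refine ⟨H.comap i, hH.comap i, ?_⟩
      exact (Homeomorph.conjMulEquiv_mem_systemAut_iff i f hf _ φ).2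
        (systemAut_anti (AddSubgroup.map_comap_le i H) hφ)
    · rintro ⟨L, hL, hψ⟩
      obtain ⟨φ, rfl⟩ := f.conjMulEquiv.surjective ψ
      exact ⟨φ, ⟨L.map i, AddSubgroup.FiniteIndex.map_of_injective hi hfin hL,
        (Homeomorph.conjMulEquiv_mem_systemAut_iff i f hf L φ).1 hψ⟩, rfl⟩
  exact ⟨(f.conjMulEquiv.subgroupMap _).trans (MulEquiv.subgroupCongr hmap)⟩

end Transport

/-- An injective homomorphism between lattices of the same rank has finite cokernel. -/
theorem AddMonoidHom.finiteIndex_range_of_injective {M N : Type*} [AddCommGroup M]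
    [AddCommGroup N] [Module.Free ℤ N] [Module.Finite ℤ N] (f : M →+ N)
    (hf : Function.Injective f) (hr : Module.finrank ℤ M = Module.finrank ℤ N) :
    f.range.FiniteIndex := by
  have : Finite (N ⧸ LinearMap.range f.toIntLinearMap) :=
    Submodule.finiteQuotientOfFreeOfRankEq _ <| by
      rw [← hr]; exact LinearMap.finrank_range_of_inj hf
  have : Finite (N ⧸ f.range) := this
  exact AddSubgroup.finiteIndex_of_finite_quotient

/-- Regrouping the cells of the lattice by `m` and renaming the symbols does not change the
stabilized automorphism group. -/
theorem nonempty_stabilizedAut_fullShift_mulEquiv {A B : Type*} [Fintype A] [Fintype B]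
    {d m : ℕ} (hd : 1 ≤ d) (hm : 0 < m) (hcard : Fintype.card A ^ m = Fintype.card B) :
    Nonempty (stabilizedAut (Fin d → ℤ) (FullShift A (Fin d → ℤ)) ≃*
      stabilizedAut (Fin d → ℤ) (FullShift B (Fin d → ℤ))) := by
  let j : Fin d := ⟨0, hd⟩
  let i : (Fin d → ℤ) →+ (Fin d → ℤ) :=
    { toFun := fun a => Function.update a j (m * a j)
      map_zero' := by simp
      map_add' := fun a b => by
        ext l
        by_cases h : l = j
        · subst h; simp [mul_add]
        · simp [h] }
  have hi : Function.Injective i := by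
    intro a b h
    ext l
    have := congrFun h l
    change Function.update a j (m * a j) l = Function.update b j (m * b j) l at this
    by_cases h : l = j
    · subst h; simpa [hm.ne'] using this
    · simpa [h] using this
  have hfin := i.finiteIndex_range_of_injective hi rfl
  have hindex : i.range.index = m := by
    let p : (Fin d → ℤ) →+ ZMod m := (Int.castAddHom (ZMod m)).comp (Pi.evalAddMonoidHom _ j)
    have hp : i.range = p.ker := by
      ext a
      constructor
      · rintro ⟨b, rfl⟩
        change ((Function.update b j (m * b j) j : ℤ) : ZMod m) = 0
        simp
      · intro ha
        obtain ⟨c, hc⟩ := (ZMod.intCast_zmod_eq_zero_iff_dvd (a j) m).1 ha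
        refine ⟨Function.update a j c, ?_⟩
        change Function.update (Function.update a j c) j _ = a
        simp [← hc]
    have hsurj : Function.Surjective p := fun z => by
      obtain ⟨c, rfl⟩ := ZMod.intCast_surjective z
      exact ⟨fun _ => c, rfl⟩
    rw [hp, AddSubgroup.index_ker, AddMonoidHom.range_eq_top.2 hsurj]
    simp
  have : Finite ((Fin d → ℤ) ⧸ i.range) := AddSubgroup.finite_quotient_of_finiteIndex
  have e : ((Fin d → ℤ) ⧸ i.range → A) ≃ B := by
    refine Nonempty.some (Finite.card_eq.1 ?_)
    rw [Nat.card_fun, Nat.card_eq_fintype_card, Nat.card_eq_fintype_card (α := B), ← hcard,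
      ← hindex]
    rfl
  exact nonempty_stabilizedAut_mulEquiv i hi hfin ((FullShift.block A i hi).trans
    (FullShift.relabel e)) fun k x => by
      simp only [Homeomorph.trans_apply, FullShift.block_vadd, FullShift.relabel_vadd]

/-! ### Finitely many automorphisms whose common centralizer consists of shifts -/

namespace FullShift

/-- The shift action as a homomorphism into the homeomorphism group. -/
def shift (A G : Type*) [AddGroup G] : Multiplicative G →* (FullShift A G ≃ₜ FullShift A G) where
  toFun g :=
    { toEquiv := AddAction.toPerm g.toAdd
      continuous_toFun := continuous_of_finite_dependence _ fun b =>
        ⟨{b + g.toAdd}, Set.finite_singleton _, fun _ _ h => h _ rfl⟩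
      continuous_invFun := continuous_of_finite_dependence _ fun b =>
        ⟨{b + -g.toAdd}, Set.finite_singleton _, fun _ _ h => h _ rfl⟩ }
  map_one' := Homeomorph.ext fun x => zero_vadd G x
  map_mul' g h := Homeomorph.ext fun x => add_vadd g.toAdd h.toAdd x

theorem shift_apply {A G : Type*} [AddGroup G] (g : Multiplicative G) (x : FullShift A G) :
    shift A G g x = g.toAdd +ᵥ x := rfl

section Track

variable {P Q G : Type*} [AddCommGroup G]

/-- On a product alphabet `P × Q`, the shift that moves only the `P`-coordinates. -/
def trackShift (P Q G : Type*) [AddCommGroup G] :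
    Multiplicative G →* (FullShift (P × Q) G ≃ₜ FullShift (P × Q) G) where
  toFun g :=
    { toFun := fun x a => ((x (a + g.toAdd)).1, (x a).2)
      invFun := fun x a => ((x (a - g.toAdd)).1, (x a).2)
      left_inv := fun x => funext fun a => by simp
      right_inv := fun x => funext fun a => by simp
      continuous_toFun := continuous_of_finite_dependence _ fun b =>
        ⟨{b + g.toAdd, b}, by simp, fun x y h => by simp [h (b + g.toAdd) (by simp), h b (by simp)]⟩
      continuous_invFun := continuous_of_finite_dependence _ fun b =>
        ⟨{b - g.toAdd, b}, by simp,
          fun x y h => by simp [h (b - g.toAdd) (by simp), h b (by simp)]⟩ }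
  map_one' := Homeomorph.ext fun x => funext fun a => by
    change ((x (a + 0)).1, (x a).2) = x a
    rw [add_zero]
  map_mul' g h := Homeomorph.ext fun x => funext fun a => by
    change ((x (a + (g.toAdd + h.toAdd))).1, (x a).2) = ((x (a + g.toAdd + h.toAdd)).1, (x a).2)
    rw [add_assoc]

theorem trackShift_apply (g : Multiplicative G) (x : FullShift (P × Q) G) (a : G) :
    trackShift P Q G g x a = ((x (a + g.toAdd)).1, (x a).2) := rfl

/-- A map commuting with all symbol permutations cannot introduce new symbols, as long as at
least two symbols are missing. -/
theorem mem_of_commute_symbolPerm {A G : Type*} [Fintype A] {φ : FullShift A G ≃ₜ FullShift A G}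
    (hφ : ∀ π, Commute φ (symbolPerm A G π)) (S : Finset A)
    (hS : S.card + 2 ≤ Fintype.card A) {x : FullShift A G} (hx : ∀ a, x a ∈ S) (a : G) :
    φ x a ∈ S := by
  classical
  by_contra hs
  obtain ⟨t, ht⟩ : ∃ t, t ∉ insert (φ x a) S := by
    by_contra! h
    have := Finset.card_insert_le (φ x a) S
    rw [Finset.eq_univ_iff_forall.2 h, Finset.card_univ] at this
    omega
  rw [Finset.mem_insert, not_or] at ht
  have h1 : symbolPerm A G (Equiv.swap (φ x a) t) x = x := funext fun b =>
    Equiv.swap_apply_of_ne_of_ne (fun h => hs (h ▸ hx b)) (fun h => ht.2 (h ▸ hx b))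
  have h2 := DFunLike.congr_fun (hφ (Equiv.swap (φ x a) t)).eq x
  simp only [Homeomorph.mul_apply, h1] at h2
  have h3 := congrFun h2 a
  rw [symbolPerm_apply, Equiv.swap_apply_left] at h3
  exact ht.1 h3.symm

/-- The configuration with `(b, c₁)` at the origin and `(b, c₀)` everywhere else. -/
def spike (G : Type*) [Zero G] [DecidableEq G] {P Q : Type*} (b : P) (c₀ c₁ : Q) :
    FullShift (P × Q) G :=
  fun a => (b, if a = 0 then c₁ else c₀)

/-- A map commuting with the symbol permutations and the track shifts moves `spike` by a shift.
Otherwise its image contains the mark `c₁` at two places; attaching a mark `b₁` to `c₁` and then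
displacing it by the difference of the two places, the symbol `(b₁, c₁)` would appear in the image
but not in the argument. -/
theorem exists_vadd_spike_eq [DecidableEq G] [Fintype P] [Fintype Q]
    (hcard : 5 ≤ Fintype.card (P × Q))
    {φ : FullShift (P × Q) G ≃ₜ FullShift (P × Q) G}
    (hφ : ∀ π, Commute φ (symbolPerm (P × Q) G π)) (hφ' : ∀ v, Commute φ (trackShift P Q G v))
    {b₀ b₁ : P} (hb : b₀ ≠ b₁) {c₀ c₁ : Q} (hc : c₀ ≠ c₁) :
    ∃ w : G, w +ᵥ φ (spike G b₀ c₀ c₁) = spike G b₀ c₀ c₁ := by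
  classical
  set p := spike G b₀ c₀ c₁ with hp
  have hS : ∀ a, φ p a = (b₀, c₀) ∨ φ p a = (b₀, c₁) := by
    intro a
    have := mem_of_commute_symbolPerm hφ {(b₀, c₀), (b₀, c₁)}
      (by have := Finset.card_le_two (a := (b₀, c₀)) (b := (b₀, c₁)); omega) (x := p)
      (fun a => by simp only [hp, spike]; split_ifs <;> simp) a
    simpa using this
  obtain ⟨w, hw⟩ : ∃ w, φ p w = (b₀, c₁) := by
    by_contra! h
    let k : FullShift (P × Q) G := fun _ => (b₀, c₀)
    have hk : φ p = φ k := by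
      refine funext fun a => ?_
      rw [(hS a).resolve_right (h a)]
      have := mem_of_commute_symbolPerm hφ {(b₀, c₀)} (by simp only [Finset.card_singleton]; omega)
        (x := k) (fun a => by simp [k]) a
      exact (Finset.mem_singleton.1 this).symm
    have := congrFun (φ.injective hk) 0
    simp [hp, spike, k, hc.symm] at this
  have huniq : ∀ u, φ p u = (b₀, c₁) → u = w := by
    intro u hu
    by_contra huw
    let π : Equiv.Perm (P × Q) := Equiv.swap (b₀, c₁) (b₁, c₁)
    let τ := trackShift P Q G (Multiplicative.ofAdd (w - u))
    have h1 := DFunLike.congr_fun (hφ' (Multiplicative.ofAdd (w - u))).eq (symbolPerm _ G π p)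
    have h2 := DFunLike.congr_fun (hφ π).eq p
    simp only [Homeomorph.mul_apply] at h1 h2
    rw [h2] at h1
    have hπ0 : π (b₀, c₀) = (b₀, c₀) :=
      Equiv.swap_apply_of_ne_of_ne (by simp [hc]) (by simp [hb])
    have hπ1 : π (b₀, c₁) = (b₁, c₁) := Equiv.swap_apply_left _ _
    have h3 := mem_of_commute_symbolPerm hφ {(b₀, c₀), (b₀, c₁), (b₁, c₀)}
      (by
        have := Finset.card_le_three (a := (b₀, c₀)) (b := (b₀, c₁)) (c := (b₁, c₀))
        omega) (x := τ (symbolPerm _ G π p))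
      (fun a => by
        simp only [τ, trackShift_apply, symbolPerm_apply, toAdd_ofAdd, hp, spike]
        by_cases h0 : a = 0
        · have h0' : a + (w - u) ≠ 0 := by rw [h0, zero_add]; exact sub_ne_zero.2 (Ne.symm huw)
          simp [h0, sub_ne_zero.2 (Ne.symm huw), hπ0, hπ1]
        · by_cases h0' : a + (w - u) = 0 <;> simp [h0, h0', hπ0, hπ1]) u
    rw [h1, trackShift_apply, symbolPerm_apply, symbolPerm_apply, toAdd_ofAdd, add_sub_cancel, hw,
      hu, hπ1] at h3
    simp [hb.symm, hc.symm] at h3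
  refine ⟨w, funext fun a => ?_⟩
  rw [vadd_apply]
  by_cases h : a = 0
  · rw [h, zero_add, hw, hp]
    simp [spike]
  · have : φ p (a + w) ≠ (b₀, c₁) := fun h' => h (by simpa using huniq _ h')
    rw [(hS _).resolve_right this, hp]
    simp [spike, h]

section Orbit

variable {s : Set (FullShift (P × Q) G)}

/-- Combining track shifts and symbol permutations, the `P`-coordinates can be permuted under the
control of the `Q`-coordinate at a prescribed displacement. -/
theorem control_fst_mem [DecidableEq Q] (hs : ∀ π, ∀ x ∈ s, symbolPerm (P × Q) G π x ∈ s)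
    (hs' : ∀ v, ∀ x ∈ s, trackShift P Q G v x ∈ s) {x : FullShift (P × Q) G} (hx : x ∈ s)
    (c : Q) (π : Equiv.Perm P) (v : G) :
    ∃ y ∈ s, ∀ a, (y a).1 = (if (x (a + v)).2 = c then π (x a).1 else (x a).1) ∧
      (y a).2 = (x a).2 := by
  refine ⟨_, hs' (Multiplicative.ofAdd v) _ (hs (Equiv.prodCongrLeft fun q =>
    if q = c then π else 1) _ (hs' (Multiplicative.ofAdd (-v)) x hx)), fun a => ⟨?_, ?_⟩⟩
  · simp only [trackShift_apply, symbolPerm_apply, toAdd_ofAdd, Equiv.prodCongrLeft_apply,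
      add_neg_cancel_right]
    split_ifs <;> rfl
  · simp only [trackShift_apply, symbolPerm_apply, Equiv.prodCongrLeft_apply]

/-- The counterpart of `control_fst_mem` with the two tracks exchanged. -/
theorem control_snd_mem [DecidableEq P] (hs : ∀ π, ∀ x ∈ s, symbolPerm (P × Q) G π x ∈ s)
    (hs' : ∀ v, ∀ x ∈ s, trackShift P Q G v x ∈ s) {x : FullShift (P × Q) G} (hx : x ∈ s)
    (b : P) (π : Equiv.Perm Q) (v : G) :
    ∃ y ∈ s, ∀ a, (y a).2 = (if (x (a + v)).1 = b then π (x a).2 else (x a).2) ∧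
      (y a).1 = (x a).1 := by
  refine ⟨_, hs' (Multiplicative.ofAdd (-v)) _ (hs (Equiv.prodCongrRight fun p =>
    if p = b then π else 1) _ (hs' (Multiplicative.ofAdd v) x hx)), fun a => ⟨?_, ?_⟩⟩
  · simp only [trackShift_apply, symbolPerm_apply, toAdd_ofAdd, Equiv.prodCongrRight_apply]
    split_ifs <;> rfl
  · simp only [trackShift_apply, symbolPerm_apply, toAdd_ofAdd, Equiv.prodCongrRight_apply,
      neg_add_cancel_right]

/-- The orbit of `spike` under symbol permutations and track shifts is dense. -/
theorem dense_of_spike_mem [DecidableEq G] [Infinite G]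
    (hs : ∀ π, ∀ x ∈ s, symbolPerm (P × Q) G π x ∈ s)
    (hs' : ∀ v, ∀ x ∈ s, trackShift P Q G v x ∈ s)
    {b₀ b₁ : P} (hb : b₀ ≠ b₁) {c₀ c₁ : Q} (hc : c₀ ≠ c₁) (hp : spike G b₀ c₀ c₁ ∈ s) :
    Dense s := by
  classical
  refine dense_of_forall_window s fun W₀ x => ?_
  let W := insert 0 W₀
  suffices ∃ y ∈ s, ∀ a ∈ W, y a = x a by
    obtain ⟨y, hy, h⟩ := this
    exact ⟨y, hy, fun a ha => h a (Finset.mem_insert_of_mem ha)⟩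
  -- a cell so far away that its translates by differences of window cells avoid the window
  obtain ⟨q, hq⟩ := Infinite.exists_notMem_finset
    ((W ×ˢ W ×ˢ W).image fun t => t.1 + t.2.1 - t.2.2)
  have hq' : ∀ a ∈ W, ∀ f ∈ W, a + (q - f) ∉ W := by
    intro a ha f hf h
    refine hq (Finset.mem_image.2 ⟨(a + (q - f), f, a), by simp [ha, hf, h], ?_⟩)
    simp only
    abel
  -- a mark `b₁` at the origin of the first track allows writing freely on the second track
  have step : ∀ F : Finset G, ∀ z : G → Q, ∃ y ∈ s, (∀ a, (y a).1 = if a = 0 then b₁ else b₀) ∧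
      ∀ a ∈ F, (y a).2 = z a := by
    intro F z
    induction F using Finset.induction_on with
    | empty =>
      obtain ⟨y, hy, h⟩ := control_fst_mem hs hs' hp c₁ (Equiv.swap b₀ b₁) 0
      refine ⟨y, hy, fun a => ?_, by simp⟩
      rw [(h a).1, add_zero]
      by_cases h0 : a = 0 <;> simp [spike, h0, hc]
    | insert f F hf ih =>
      obtain ⟨y, hy, h1, h2⟩ := ih
      obtain ⟨y', hy', h⟩ := control_snd_mem hs hs' hy b₁ (Equiv.swap (y f).2 (z f)) (-f)
      have hcond : ∀ a, (y (a + -f)).1 = b₁ ↔ a = f := by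
        intro a
        rw [h1]
        by_cases h0 : a + -f = 0
        · simp [add_neg_eq_zero.1 h0]
        · have haf : a ≠ f := fun h => h0 (by simp [h])
          simp [h0, hb, haf]
      refine ⟨y', hy', fun a => by rw [(h a).2, h1], fun a ha => ?_⟩
      rw [(h a).1]
      by_cases haf : a = f
      · rw [if_pos ((hcond a).2 haf), haf, Equiv.swap_apply_left]
      · rw [if_neg (mt (hcond a).1 haf), h2 a (Finset.mem_of_mem_insert_of_ne ha haf)]
  obtain ⟨y₀, hy₀, -, hz⟩ := step
    (insert q W ∪ (W ×ˢ W).image fun t => t.1 + (q - t.2))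
    fun a => if a = q then c₁ else if a ∈ W then (x a).2 else c₀
  have hqW : q ∉ W := by
    have := hq' 0 (by simp [W]) 0 (by simp [W])
    simpa using this
  -- the far mark `c₁` at `q` now allows writing freely on the first track inside the window
  have step' : ∀ V ⊆ W, ∃ y ∈ s, (∀ a, (y a).2 = (y₀ a).2) ∧ ∀ a ∈ V, (y a).1 = (x a).1 := by
    intro V
    induction V using Finset.induction_on with
    | empty => exact fun _ => ⟨y₀, hy₀, fun _ => rfl, by simp⟩
    | insert f V hf ih =>
      intro hV
      obtain ⟨y, hy, h1, h2⟩ := ih ((Finset.subset_insert f V).trans hV)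
      obtain ⟨y', hy', h⟩ := control_fst_mem hs hs' hy c₁ (Equiv.swap (y f).1 (x f).1) (q - f)
      refine ⟨y', hy', fun a => by rw [(h a).2, h1], fun a ha => ?_⟩
      have hfW := hV (Finset.mem_insert_self f V)
      have haW := hV ha
      have hval : (y (a + (q - f))).2 = if a = f then c₁ else c₀ := by
        rw [h1, hz _ (Finset.mem_union_right _
          (Finset.mem_image.2 ⟨(a, f), Finset.mk_mem_product haW hfW, rfl⟩))]
        by_cases haf : a = f
        · simp [haf]
        · have : a + (q - f) ≠ q := fun h => haf <| by
            rwa [add_sub_left_comm, add_eq_left, sub_eq_zero] at h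
          rw [if_neg this, if_neg (hq' a haW f hfW), if_neg haf]
      rw [(h a).1, hval]
      by_cases haf : a = f
      · simp [haf]
      · simp [haf, hc, h2 a (Finset.mem_of_mem_insert_of_ne ha haf)]
  obtain ⟨y, hy, h1, h2⟩ := step' W subset_rfl
  refine ⟨y, hy, fun a ha => Prod.ext (h2 a ha) ?_⟩
  rw [h1, hz a (by simp [ha]), if_neg (by rintro rfl; exact hqW ha), if_pos ha]

end Orbit

/-- The common centralizer of the symbol permutations and the track shifts consists of shifts:
up to a shift, an element of it fixes `spike`, hence all points of a dense orbit. -/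
theorem exists_eq_shift_of_commute [Infinite G] [Fintype P] [Fintype Q] [Nontrivial P]
    [Nontrivial Q] (hcard : 5 ≤ Fintype.card (P × Q))
    {φ : FullShift (P × Q) G ≃ₜ FullShift (P × Q) G}
    (hφ : ∀ π, Commute φ (symbolPerm (P × Q) G π)) (hφ' : ∀ v, Commute φ (trackShift P Q G v)) :
    ∃ w, φ = shift (P × Q) G w := by
  classical
  obtain ⟨b₀, b₁, hb⟩ := exists_pair_ne P
  obtain ⟨c₀, c₁, hc⟩ := exists_pair_ne Q
  obtain ⟨w, hw⟩ := exists_vadd_spike_eq hcard hφ hφ' hb hc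
  let ψ := shift (P × Q) G (Multiplicative.ofAdd w) * φ
  have hψ : ∀ π, Commute ψ (symbolPerm (P × Q) G π) := fun π =>
    Commute.mul_left rfl (hφ π)
  have hψ' : ∀ v, Commute ψ (trackShift P Q G v) := fun v =>
    Commute.mul_left (Homeomorph.ext fun x => funext fun a => by
      simp only [Homeomorph.mul_apply, trackShift_apply, shift_apply, vadd_apply]
      rw [add_right_comm]) (hφ' v)
  have hd : Dense {x | ψ x = x} := by
    refine dense_of_spike_mem (fun π x hx => ?_) (fun v x hx => ?_) hb hc hw
    · have := DFunLike.congr_fun (hψ π).eq x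
      simp only [Homeomorph.mul_apply, Set.mem_ofPred_eq] at this hx ⊢
      rw [this, hx]
    · have := DFunLike.congr_fun (hψ' v).eq x
      simp only [Homeomorph.mul_apply, Set.mem_ofPred_eq] at this hx ⊢
      rw [this, hx]
  have h1 : ψ = 1 := Homeomorph.ext fun x =>
    congrFun (Continuous.ext_on hd ψ.continuous continuous_id fun _ h => h) x
  exact ⟨_, by rw [map_inv]; exact eq_inv_of_mul_eq_one_right h1⟩

theorem symbolPerm_mem_systemAut {A : Type*} (H : AddSubgroup G) (π : Equiv.Perm A) :
    symbolPerm A G π ∈ systemAut H (FullShift A G) := fun _ _ => rfl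

theorem trackShift_mem_systemAut (H : AddSubgroup G) (v : Multiplicative G) :
    trackShift P Q G v ∈ systemAut H (FullShift (P × Q) G) := fun g x => funext fun a => by
  change ((x (a + v.toAdd + g)).1, (x (a + g)).2) = ((x (a + g + v.toAdd)).1, (x (a + g)).2)
  rw [add_right_comm]

theorem systemAut_le_stabilizedAut {X : Type*} [TopologicalSpace X] [AddAction G X]
    (H : AddSubgroup G) [hH : H.FiniteIndex] : systemAut H X ≤ stabilizedAut G X :=
  fun _ hφ => ⟨H, hH, hφ⟩

/-- A finite subset of the stabilized automorphism group has only shifts in its centralizer. -/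
theorem exists_finite_centralizer_le_shift [Infinite G] [AddGroup.FG G] [Fintype P] [Fintype Q]
    [Nontrivial P] [Nontrivial Q] (hcard : 5 ≤ Fintype.card (P × Q)) :
    ∃ F : Set (stabilizedAut G (FullShift (P × Q) G)), F.Finite ∧
      ∀ φ : stabilizedAut G (FullShift (P × Q) G), (∀ f ∈ F, Commute f φ) →
        ∃ w, (φ : FullShift (P × Q) G ≃ₜ FullShift (P × Q) G) = shift (P × Q) G w := by
  let S₁ := (symbolPerm (P × Q) G).codRestrict (stabilizedAut G (FullShift (P × Q) G))
    fun π => systemAut_le_stabilizedAut ⊤ (symbolPerm_mem_systemAut ⊤ π)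
  let S₂ := (trackShift P Q G).codRestrict (stabilizedAut G (FullShift (P × Q) G))
    fun v => systemAut_le_stabilizedAut ⊤ (trackShift_mem_systemAut ⊤ v)
  obtain ⟨E, hE⟩ := (inferInstance : Group.FG (Multiplicative G)).out
  refine ⟨Set.range S₁ ∪ S₂ '' E, (Set.finite_range _).union (E.finite_toSet.image _),
    fun φ hφ => exists_eq_shift_of_commute hcard (fun π => ?_) fun v => ?_⟩
  · exact (congrArg Subtype.val (hφ (S₁ π) (Or.inl ⟨π, rfl⟩)).symm.eq :)
  · have hle : (⊤ : Subgroup (Multiplicative G)) ≤ (Subgroup.centralizer {φ}).comap S₂ := by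
      rw [← hE, Subgroup.closure_le]
      exact fun e he => Subgroup.mem_centralizer_singleton_iff.2 (hφ _ (Or.inr ⟨e, he, rfl⟩)).eq
    have := Subgroup.mem_centralizer_singleton_iff.1 (hle (Subgroup.mem_top v))
    exact (congrArg Subtype.val this.symm :)

end Track

end FullShift

/-! ### Permutation representations of the groups `Aut(X, K)` -/

namespace FullShift

section Lower

variable {A G : Type*} [AddCommGroup G]

/-- The permutations of the set of patterns on a system of coset representatives of `K` embed
into `Aut(X, K)`; a permutation of the alphabet applied in all cells is in the image. -/
theorem exists_perm_hom_systemAut (A : Type*) (K : AddSubgroup G) [K.FiniteIndex] :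
    ∃ j : Equiv.Perm (G ⧸ K.subtype.range → A) →* systemAut K (FullShift A G),
      ∀ π : Equiv.Perm A, (j (Equiv.piCongrRight fun _ => π) : FullShift A G ≃ₜ FullShift A G) =
        symbolPerm A G π := by
  have hi : Function.Injective K.subtype := K.subtype_injective
  have : Finite (G ⧸ K.subtype.range) := by
    rw [AddSubgroup.range_subtype]; exact AddSubgroup.finite_quotient_of_finiteIndex
  let c := (block A K.subtype hi).conjMulEquiv
  refine ⟨(c.symm.toMonoidHom.comp (symbolPerm (G ⧸ K.subtype.range → A) K)).codRestrict _
    fun ρ => ?_, fun π => ?_⟩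
  · have := (Homeomorph.conjMulEquiv_mem_systemAut_iff K.subtype (block A K.subtype hi)
      (block_vadd K.subtype hi) ⊤ (c.symm (symbolPerm _ K ρ))).1 (by
        change c (c.symm _) ∈ _
        rw [c.apply_symm_apply]
        exact symbolPerm_mem_systemAut _ _)
    refine systemAut_anti (fun k hk => ?_) this
    exact ⟨⟨k, hk⟩, trivial, rfl⟩
  · change c.symm (symbolPerm _ K (Equiv.piCongrRight fun _ => π)) = _
    rw [MulEquiv.symm_apply_eq]
    refine Homeomorph.ext fun y => ?_
    obtain ⟨x, rfl⟩ := (block A K.subtype hi).surjective y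
    rw [Homeomorph.conjMulEquiv_apply, Homeomorph.symm_apply_apply]
    rfl

/-- A permutation representation of `Aut(X, K)` that does not kill a symbol permutation of
order three is faithful on the permutations of the patterns on a system of coset representatives
of `K`, because nontrivial normal subgroups of a symmetric group contain the alternating group. -/
theorem card_pow_index_le [Fintype A] (hA : 5 ≤ Fintype.card A) (K : AddSubgroup G)
    [K.FiniteIndex] {π : Equiv.Perm A} (hπ : π ^ 3 = 1) {n : ℕ}
    (f : systemAut K (FullShift A G) →* Equiv.Perm (Fin n))
    (hf : f ⟨symbolPerm A G π, symbolPerm_mem_systemAut K π⟩ ≠ 1) :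
    Fintype.card A ^ K.index ≤ n := by
  classical
  obtain ⟨j, hj⟩ := exists_perm_hom_systemAut A K
  have : Finite (G ⧸ K.subtype.range) := by
    rw [AddSubgroup.range_subtype]; exact AddSubgroup.finite_quotient_of_finiteIndex
  have := Fintype.ofFinite (G ⧸ K.subtype.range)
  let Z := G ⧸ K.subtype.range → A
  have hcard : Nat.card Z = Fintype.card A ^ K.index := by
    rw [Nat.card_fun, Nat.card_eq_fintype_card]
    change _ ^ K.subtype.range.index = _
    rw [AddSubgroup.range_subtype]
  have h5 : 5 ≤ Nat.card Z := hcard ▸ hA.trans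
    (Nat.le_self_pow AddSubgroup.FiniteIndex.index_ne_zero _)
  let ρ : Equiv.Perm Z := Equiv.piCongrRight fun _ => π
  have hjρ : j ρ = ⟨symbolPerm A G π, symbolPerm_mem_systemAut K π⟩ := Subtype.ext (hj π)
  have hρ3 : ρ ^ 3 = 1 := Equiv.ext fun z => funext fun q => DFunLike.congr_fun hπ (z q)
  have hker : (f.comp j).ker = ⊥ := by
    by_contra hne
    have hle := Equiv.Perm.alternatingGroup_le_of_normal h5
      ((Subgroup.nontrivial_iff_ne_bot _).2 hne)
    have hρ : ρ ∈ alternatingGroup Z := by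
      have := congrArg Equiv.Perm.sign hρ3
      rw [map_pow, map_one, pow_succ, Int.units_sq, one_mul] at this
      exact Equiv.Perm.mem_alternatingGroup.2 this
    have := MonoidHom.mem_ker.1 (hle hρ)
    rw [MonoidHom.comp_apply, hjρ] at this
    exact hf this
  have hle := Nat.card_le_card_of_injective _ ((MonoidHom.ker_eq_bot_iff _).1 hker)
  rw [Nat.card_perm, Nat.card_perm, Nat.card_fin, hcard] at hle
  by_contra! hlt
  rcases Nat.eq_zero_or_pos n with rfl | hn
  · have := Nat.self_le_factorial (Fintype.card A ^ K.index)
    rw [Nat.factorial_zero] at hle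
    omega
  · exact absurd ((Nat.factorial_lt hn).2 hlt) hle.not_gt

end Lower

section Upper

variable {A G : Type*} [AddCommGroup G]

/-- A configuration fixed by `K` is a function on the quotient by `K`. -/
def fixedEquiv (A : Type*) (K : AddSubgroup G) :
    {x : FullShift A G // ∀ k ∈ K, k +ᵥ x = x} ≃ (G ⧸ K → A) where
  toFun x := fun q => Quotient.liftOn' q x.1 fun a b h => by
    rw [QuotientAddGroup.leftRel_apply] at h
    have := congrFun (x.2 _ h) a
    rw [vadd_apply, add_neg_cancel_left] at this
    exact this.symm
  invFun y := ⟨fun a => y a, fun k hk => funext fun a =>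
    congrArg y (QuotientAddGroup.mk_add_of_mem a hk)⟩
  left_inv x := rfl
  right_inv y := funext fun q => by
    obtain ⟨a, rfl⟩ := QuotientAddGroup.mk_surjective q
    rfl

/-- The action of `Aut(X, K)` on the configurations fixed by `K`. -/
theorem exists_perm_rep_of_fixed [Fintype A] (K : AddSubgroup G) [K.FiniteIndex]
    (φ : systemAut K (FullShift A G)) {x : FullShift A G} (hx : ∀ k ∈ K, k +ᵥ x = x)
    (hφ : φ.1 x ≠ x) :
    ∃ f : systemAut K (FullShift A G) →* Equiv.Perm (Fin (Fintype.card A ^ K.index)),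
      f φ ≠ 1 := by
  have : Finite (G ⧸ K) := AddSubgroup.finite_quotient_of_finiteIndex
  have hcard : Nat.card {x : FullShift A G // ∀ k ∈ K, k +ᵥ x = x} =
      Fintype.card A ^ K.index := by
    rw [Nat.card_congr (fixedEquiv A K), Nat.card_fun, Nat.card_eq_fintype_card]
    rfl
  have : Finite {x : FullShift A G // ∀ k ∈ K, k +ᵥ x = x} :=
    Finite.of_equiv _ (fixedEquiv A K).symm
  have hstable : ∀ (ψ : systemAut K (FullShift A G)) (x : FullShift A G),
      (∀ k ∈ K, k +ᵥ ψ.1.toEquiv x = ψ.1.toEquiv x) ↔ ∀ k ∈ K, k +ᵥ x = x := by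
    intro ψ x
    refine forall₂_congr fun k hk => ?_
    have : ψ.1 (k +ᵥ x) = k +ᵥ ψ.1 x := ψ.2 ⟨k, hk⟩ x
    change k +ᵥ ψ.1 x = ψ.1 x ↔ _
    rw [← this]
    exact ψ.1.injective.eq_iff
  let r : systemAut K (FullShift A G) →*
      Equiv.Perm {x : FullShift A G // ∀ k ∈ K, k +ᵥ x = x} :=
    { toFun := fun ψ => Equiv.Perm.subtypePerm ψ.1.toEquiv (hstable ψ)
      map_one' := rfl
      map_mul' := fun _ _ => rfl }
  let e := (Finite.equivFinOfCardEq hcard).permCongrHom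
  refine ⟨e.toMonoidHom.comp r, fun h => hφ ?_⟩
  have h1 : r φ = 1 := e.injective (h.trans (map_one e).symm)
  exact congrArg Subtype.val (DFunLike.congr_fun h1 ⟨x, hx⟩)

/-- Periodic configurations are dense: a nontrivial homeomorphism of the full shift over a lattice
moves a periodic configuration. -/
theorem exists_periodic_ne {d : ℕ} {φ : FullShift A (Fin d → ℤ) ≃ₜ FullShift A (Fin d → ℤ)}
    (hφ : φ ≠ 1) : ∃ L : AddSubgroup (Fin d → ℤ), L.FiniteIndex ∧ ∃ x : FullShift A (Fin d → ℤ),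
      (∀ k ∈ L, k +ᵥ x = x) ∧ φ x ≠ x := by
  obtain ⟨x, hx⟩ : ∃ x, φ x ≠ x := by
    by_contra! h
    exact hφ (Homeomorph.ext h)
  obtain ⟨W, hW⟩ := exists_window_of_mem_nhds
    ((isOpen_ne_fun φ.continuous continuous_id).mem_nhds hx)
  let M := W.sup fun a => Finset.univ.sup fun i => (a i).natAbs
  have hM : ∀ a ∈ W, ∀ i, (a i).natAbs ≤ M := fun a ha i =>
    (Finset.le_sup (f := fun i => (a i).natAbs) (Finset.mem_univ i)).trans
      (Finset.le_sup (f := fun a => Finset.univ.sup fun i => (a i).natAbs) ha)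
  -- balanced residues modulo `2 * M + 1` are the identity on the window
  let p : (Fin d → ℤ) →+ (Fin d → ZMod (2 * M + 1)) :=
    { toFun := fun a i => (a i : ZMod (2 * M + 1))
      map_zero' := by ext; simp
      map_add' := fun a b => by ext; simp }
  refine ⟨p.ker, inferInstance, fun a => x fun i => (a i).bmod (2 * M + 1), fun k hk => ?_, ?_⟩
  · refine funext fun a => congrArg x (funext fun i => ?_)
    obtain ⟨c, hc⟩ := (ZMod.intCast_zmod_eq_zero_iff_dvd (k i) (2 * M + 1)).1
      (congrFun (AddMonoidHom.mem_ker.1 hk) i)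
    rw [Pi.add_apply, hc, Int.add_mul_bmod_self_left]
  · refine hW _ fun a ha => congrArg x (funext fun i => ?_)
    have := hM a ha i
    exact Int.bmod_eq_of_le (by omega) (by omega)

end Upper

end FullShift

/-! ### Isomorphisms match the shifts on finite index subgroups -/

namespace FullShift

theorem shift_injective {A G : Type*} [AddGroup G] [Nontrivial A] :
    Function.Injective (shift A G) := by
  classical
  intro v w h
  obtain ⟨a, b, hab⟩ := exists_pair_ne A
  let x : FullShift A G := fun g => if g = v.toAdd then a else b
  have := congrFun (DFunLike.congr_fun h x) 0
  rw [shift_apply, shift_apply, vadd_apply, vadd_apply, zero_add, zero_add] at this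
  change (if v.toAdd = v.toAdd then a else b) = if w.toAdd = v.toAdd then a else b at this
  rw [if_pos rfl] at this
  by_contra hvw
  rw [if_neg fun h => hvw (Multiplicative.toAdd.injective h.symm)] at this
  exact hab this

theorem symbolPerm_injective {A G : Type*} [AddGroup G] :
    Function.Injective (symbolPerm A G) := fun _ _ h => Equiv.ext fun a =>
  congrFun (DFunLike.congr_fun h fun _ : G => a) 0

section StabShift

variable {A G : Type*} [AddCommGroup G]

/-- The shifts as elements of the stabilized automorphism group. -/
def stabShift (A G : Type*) [AddCommGroup G] :
    Multiplicative G →* stabilizedAut G (FullShift A G) :=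
  (shift A G).codRestrict _ fun v => systemAut_le_stabilizedAut ⊤ fun g x => by
    rw [shift_apply, shift_apply]
    exact vadd_comm _ _ _

/-- The group `Aut(X, K)` is the centralizer of the shifts by elements of `K`. -/
theorem mem_systemAut_iff_commute (K : AddSubgroup G) (φ : stabilizedAut G (FullShift A G)) :
    φ.1 ∈ systemAut K (FullShift A G) ↔
      ∀ k ∈ K, Commute φ (stabShift A G (Multiplicative.ofAdd k)) :=
  ⟨fun h k hk => Subtype.ext (Homeomorph.ext fun x => h ⟨k, hk⟩ x),
    fun h k x => DFunLike.congr_fun (congrArg Subtype.val (h k k.2).eq) x⟩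

end StabShift

/-- For large product alphabets, an isomorphism of stabilized automorphism groups matches the
shifts by a finite index subgroup `L` on one side with shifts on the other side: the preimage of
a shift by an element of `L` centralizes a finite set that only shifts centralize. -/
theorem exists_hom_stabShift {P Q B : Type*} [Fintype P] [Fintype Q] [Nontrivial P] [Nontrivial Q]
    [Nontrivial B] (hcard : 5 ≤ Fintype.card (P × Q)) {d : ℕ} (hd : 1 ≤ d)
    (Ψ : stabilizedAut (Fin d → ℤ) (FullShift (P × Q) (Fin d → ℤ)) ≃*
      stabilizedAut (Fin d → ℤ) (FullShift B (Fin d → ℤ))) :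
    ∃ (L : AddSubgroup (Fin d → ℤ)) (θ : L →+ (Fin d → ℤ)), L.FiniteIndex ∧
      Function.Injective θ ∧ θ.range.FiniteIndex ∧
      ∀ l : L, Ψ (stabShift (P × Q) _ (Multiplicative.ofAdd (θ l))) =
        stabShift B _ (Multiplicative.ofAdd (l : Fin d → ℤ)) := by
  have : Nonempty (Fin d) := ⟨⟨0, hd⟩⟩
  have : AddGroup.FG (Fin d → ℤ) := Module.Finite.iff_addGroup_fg.1 inferInstance
  obtain ⟨F, hF, hcent⟩ := exists_finite_centralizer_le_shift (G := Fin d → ℤ) hcard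
  have : Finite F := hF
  choose H hH hmem using fun f : F => (Ψ f).2
  let L : AddSubgroup (Fin d → ℤ) := ⨅ f, H f
  have hL : L.FiniteIndex := AddSubgroup.finiteIndex_iInf hH
  have key : ∀ l : L, ∃ w : Fin d → ℤ, Ψ (stabShift (P × Q) _ (Multiplicative.ofAdd w)) =
      stabShift B _ (Multiplicative.ofAdd (l : Fin d → ℤ)) := by
    intro l
    obtain ⟨w, hw⟩ := hcent (Ψ.symm (stabShift B _ (Multiplicative.ofAdd (l : Fin d → ℤ))))
      fun f hf => by
        have h := (mem_systemAut_iff_commute (H ⟨f, hf⟩) (Ψ f)).1 (hmem ⟨f, hf⟩) l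
          (AddSubgroup.mem_iInf.1 l.2 ⟨f, hf⟩)
        have := h.map Ψ.symm
        rwa [Ψ.symm_apply_apply] at this
    refine ⟨w.toAdd, ?_⟩
    rw [← Ψ.eq_symm_apply]
    exact Subtype.ext hw.symm
  have hinjP : Function.Injective (stabShift (P × Q) (Fin d → ℤ)) := fun v w h =>
    shift_injective (congrArg Subtype.val h)
  have hinjB : Function.Injective (stabShift B (Fin d → ℤ)) := fun v w h =>
    shift_injective (congrArg Subtype.val h)
  choose θ hθ using key
  let Θ : L →+ (Fin d → ℤ) := AddMonoidHom.mk' θ fun l l' => by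
    apply Multiplicative.ofAdd.injective
    apply hinjP
    apply Ψ.injective
    rw [hθ, ofAdd_add, map_mul, map_mul, hθ, hθ, ← map_mul]
    rfl
  have hΘ : Function.Injective Θ := fun l l' h => by
    have h' : θ l = θ l' := h
    have := hθ l
    rw [h', hθ l'] at this
    exact Subtype.ext (Multiplicative.ofAdd.injective (hinjB this)).symm
  have hrank : Module.finrank ℤ L = Module.finrank ℤ (Fin d → ℤ) := by
    have : Finite ((Fin d → ℤ) ⧸ L.toIntSubmodule) := AddSubgroup.finite_quotient_of_finiteIndex
      (H := L)
    exact (Submodule.finiteQuotient_iff L.toIntSubmodule).1 this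
  exact ⟨L, Θ, hL, hΘ, Θ.finiteIndex_range_of_injective hΘ hrank, hθ⟩

/-! ### Comparison of the numbers of periodic configurations -/

theorem exists_perm_pow_three {A : Type*} [Fintype A] (hA : 5 ≤ Fintype.card A) :
    ∃ π : Equiv.Perm A, π ^ 3 = 1 ∧ π ≠ 1 := by
  classical
  obtain ⟨a, b, c, hab, hac, hbc⟩ := Fintype.two_lt_card_iff.1 (show 2 < Fintype.card A by omega)
  have h := Equiv.Perm.isThreeCycle_swap_mul_swap_same hab hac hbc
  refine ⟨_, h.orderOf ▸ pow_orderOf_eq_one _, fun h1 => ?_⟩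
  have := h.orderOf
  rw [h1, orderOf_one] at this
  omega

/-- If a homomorphism maps `Aut(X, K')` to `Aut(Y, K)` and the image of a symbol permutation of
order three moves a `K`-periodic configuration, then `Y` has at least as many `K`-periodic
configurations as `X` has `K'`-periodic ones. -/
theorem card_pow_index_le_of_hom {A B G : Type*} [AddCommGroup G] [Fintype A] [Fintype B]
    (hA : 5 ≤ Fintype.card A) {K K' : AddSubgroup G} [K.FiniteIndex] [hK' : K'.FiniteIndex]
    (Ψ : stabilizedAut G (FullShift A G) →* stabilizedAut G (FullShift B G))
    (hΨ : ∀ φ, φ.1 ∈ systemAut K' (FullShift A G) → (Ψ φ).1 ∈ systemAut K (FullShift B G))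
    {π : Equiv.Perm A} (hπ : π ^ 3 = 1) (s : stabilizedAut G (FullShift A G))
    (hs : s.1 = symbolPerm A G π) {x : FullShift B G} (hx : ∀ k ∈ K, k +ᵥ x = x)
    (hne : (Ψ s).1 x ≠ x) :
    Fintype.card A ^ K'.index ≤ Fintype.card B ^ K.index := by
  let h : systemAut K' (FullShift A G) →* systemAut K (FullShift B G) :=
    (((stabilizedAut G (FullShift B G)).subtype.comp Ψ).comp
      (Subgroup.inclusion (systemAut_le_stabilizedAut K'))).codRestrict _ fun φ => hΨ _ φ.2
  let σ : systemAut K' (FullShift A G) := ⟨symbolPerm A G π, symbolPerm_mem_systemAut K' π⟩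
  have hσ : (h σ).1 = (Ψ s).1 := by
    change (Ψ (Subgroup.inclusion _ σ)).1 = _
    congr 2
    exact Subtype.ext hs.symm
  obtain ⟨f, hf⟩ := exists_perm_rep_of_fixed K (h σ) hx (by rwa [hσ])
  exact card_pow_index_le hA K' hπ (f.comp h) hf

/-- For large product alphabets, isomorphic stabilized automorphism groups force the alphabets
to have a common power. -/
theorem exists_pow_card_eq_of_mulEquiv {P Q P' Q' : Type*} [Fintype P] [Fintype Q] [Fintype P']
    [Fintype Q'] [Nontrivial P] [Nontrivial Q] [Nontrivial P'] [Nontrivial Q']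
    (hA : 5 ≤ Fintype.card (P × Q)) (hB : 5 ≤ Fintype.card (P' × Q')) {d : ℕ} (hd : 1 ≤ d)
    (Ψ : stabilizedAut (Fin d → ℤ) (FullShift (P × Q) (Fin d → ℤ)) ≃*
      stabilizedAut (Fin d → ℤ) (FullShift (P' × Q') (Fin d → ℤ))) :
    ∃ m n : ℕ, 0 < m ∧ 0 < n ∧ Fintype.card (P × Q) ^ m = Fintype.card (P' × Q') ^ n := by
  obtain ⟨L, θ, hL, hθ, hθfin, hΨ⟩ := exists_hom_stabShift hA hd Ψ
  have hmem : ∀ (κ : AddSubgroup L) (φ),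
      φ.1 ∈ systemAut (κ.map θ) (FullShift (P × Q) (Fin d → ℤ)) ↔
        (Ψ φ).1 ∈ systemAut (κ.map L.subtype) (FullShift (P' × Q') (Fin d → ℤ)) := by
    intro κ φ
    rw [mem_systemAut_iff_commute, mem_systemAut_iff_commute]
    simp only [AddSubgroup.mem_map, forall_exists_index, and_imp, forall_apply_eq_imp_iff₂]
    refine forall₂_congr fun l _ => ?_
    rw [AddSubgroup.subtype_apply, ← hΨ, commute_iff_eq, commute_iff_eq, ← map_mul, ← map_mul,
      Ψ.injective.eq_iff]
  obtain ⟨π, hπ, hπ1⟩ := exists_perm_pow_three hA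
  obtain ⟨ρ, hρ, hρ1⟩ := exists_perm_pow_three hB
  let s : stabilizedAut (Fin d → ℤ) (FullShift (P × Q) (Fin d → ℤ)) :=
    ⟨symbolPerm _ _ π, systemAut_le_stabilizedAut ⊤ (symbolPerm_mem_systemAut _ _)⟩
  let t : stabilizedAut (Fin d → ℤ) (FullShift (P' × Q') (Fin d → ℤ)) :=
    ⟨symbolPerm _ _ ρ, systemAut_le_stabilizedAut ⊤ (symbolPerm_mem_systemAut _ _)⟩
  have hs : (Ψ s).1 ≠ 1 := fun h => hπ1 <| symbolPerm_injective <| by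
    have : s = 1 := Ψ.injective ((Subtype.ext h).trans (map_one Ψ).symm)
    rw [map_one]
    exact congrArg Subtype.val this
  have ht : (Ψ.symm t).1 ≠ 1 := fun h => hρ1 <| symbolPerm_injective <| by
    have : t = 1 := Ψ.symm.injective ((Subtype.ext h).trans (map_one Ψ.symm).symm)
    rw [map_one]
    exact congrArg Subtype.val this
  obtain ⟨M, hM, x, hx, hxne⟩ := exists_periodic_ne hs
  obtain ⟨N, hN, y, hy, hyne⟩ := exists_periodic_ne ht
  -- a subgroup deep enough for both comparisons
  let κ : AddSubgroup L := M.comap L.subtype ⊓ N.comap θ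
  have hκ : κ.FiniteIndex :=
    have := hM.comap L.subtype
    have := hN.comap θ
    inferInstance
  have hK : (κ.map L.subtype).FiniteIndex :=
    AddSubgroup.FiniteIndex.map_of_injective L.subtype_injective
      (by rwa [AddSubgroup.range_subtype]) hκ
  have hK' : (κ.map θ).FiniteIndex := AddSubgroup.FiniteIndex.map_of_injective hθ hθfin hκ
  refine ⟨(κ.map θ).index, (κ.map L.subtype).index, Nat.pos_of_ne_zero hK'.index_ne_zero,
    Nat.pos_of_ne_zero hK.index_ne_zero, le_antisymm ?_ ?_⟩
  · refine card_pow_index_le_of_hom hA Ψ.toMonoidHom (fun φ => (hmem κ φ).1) hπ s rfl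
      (x := x) ?_ hxne
    rintro _ ⟨l, hl, rfl⟩
    exact hx _ hl.1
  · refine card_pow_index_le_of_hom hB Ψ.symm.toMonoidHom (fun ψ hψ => (hmem κ _).2 ?_) hρ t rfl
      (x := y) ?_ hyne
    · change (Ψ (Ψ.symm ψ)).1 ∈ _
      rwa [Ψ.apply_symm_apply]
    · rintro _ ⟨l, hl, rfl⟩
      exact hy _ hl.2

end FullShift

/-! ### Classification -/

theorem mainTheorem1 (A B : Type*) [Fintype A] [Fintype B]
    (hA : 2 ≤ Fintype.card A) (hB : 2 ≤ Fintype.card B) (d : ℕ) (hd : 1 ≤ d) :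
    Nonempty (stabilizedAut (Fin d → ℤ) (FullShift A (Fin d → ℤ)) ≃*
        stabilizedAut (Fin d → ℤ) (FullShift B (Fin d → ℤ))) ↔
      ∃ m n : ℕ, 0 < m ∧ 0 < n ∧ Fintype.card A ^ m = Fintype.card B ^ n := by
  constructor
  · rintro ⟨Ψ⟩
    have : Nontrivial A := Fintype.one_lt_card_iff_nontrivial.1 hA
    have : Nontrivial B := Fintype.one_lt_card_iff_nontrivial.1 hB
    have hcard : ∀ c : ℕ, c * (c * c) = c ^ 3 := fun c => by ring
    have h5 : ∀ c : ℕ, 2 ≤ c → 5 ≤ c ^ 3 := fun c hc =>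
      (by norm_num : 5 ≤ 2 ^ 3).trans (Nat.pow_le_pow_left hc 3)
    have hA3 : Fintype.card (A × A × A) = Fintype.card A ^ 3 := by
      rw [Fintype.card_prod, Fintype.card_prod, hcard]
    have hB3 : Fintype.card (B × B × B) = Fintype.card B ^ 3 := by
      rw [Fintype.card_prod, Fintype.card_prod, hcard]
    obtain ⟨e⟩ := nonempty_stabilizedAut_fullShift_mulEquiv hd three_pos hA3.symm
    obtain ⟨e'⟩ := nonempty_stabilizedAut_fullShift_mulEquiv hd three_pos hB3.symm
    obtain ⟨m, n, hm, hn, h⟩ := FullShift.exists_pow_card_eq_of_mulEquiv (hA3 ▸ h5 _ hA)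
      (hB3 ▸ h5 _ hB) hd ((e.symm.trans Ψ).trans e')
    rw [hA3, hB3, ← pow_mul, ← pow_mul] at h
    exact ⟨3 * m, 3 * n, by omega, by omega, h⟩
  · rintro ⟨m, n, hm, hn, h⟩
    obtain ⟨e⟩ := nonempty_stabilizedAut_fullShift_mulEquiv (A := A) (B := Fin m → A) hd hm
      (by simp)
    obtain ⟨e'⟩ := nonempty_stabilizedAut_fullShift_mulEquiv (A := B) (B := Fin m → A) hd hn
      (by simp [h])
    exact ⟨e.trans e'.symm⟩
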